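/- Tensors in $\mathbb R^{n_1\times\dots\times n_D}$ carry the Euclidean (Frobenius) norm, and $R$-tuples of tensors the product Euclidean norm. $(U_1,\dots,U_D)\cdot\mathcal C=(U_1\otimes\dots\otimes U_D)\,\mathcal C$ denotes multilinear multiplication. A Tucker core structure is a smooth embedded submanifold $\mathcal M\subseteq\mathbb R^{l_1\times\dots\times l_D}$, all of whose elements have multilinear rank $(l_1,\dots,l_D)$, that is invariant under $\mathcal C\mapsto (G_1,\dots,G_D)\cdot\mathcal C$ for all $G_d\in\mathrm{GL}(l_d)$. Let $\mathcal M^{n_1,\dots,n_D}$ be the set of all tensors $(U_1,\dots,U_D)\cdot\mathcal C\in\mathbb R^{n_1\times\dots\times n_D}$ with $\mathcal C\in\mathcal M$ and $U_d\in\mathbb R^{n_d\times l_d}$ of rank $l_d$. Let $R\ge 1$ and $l^r_d\ge 1$ for $r=1,\dots,R$ and $d=1,\dots,D$. Let $\mathcal M_r\subseteq\mathbb R^{l^r_1\times\dots\times l^r_D}$ be Tucker core structures, and let $\mathcal A=\mathcal A_1+\dots+\mathcal A_R$ with $\mathcal A_r\in\mathcal M_r^{n_1,\dots,n_D}$; this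 is called an SBTD (structured block term decomposition) of $\mathcal A$. When each $\mathcal M_r$ is the set $\mathcal N_r$ of all tensors in $\mathbb R^{l^r_1\times\dots\times l^r_D}$ of multilinear rank $(l^r_1,\dots,l^r_D)$, it is called a BTD (block term decomposition). The condition number $\kappa^{\mathrm{SBTD}}(\mathcal A_1,\dots,\mathcal A_R)\in[0,\infty]$ is defined as follows. Let $\Sigma:\mathcal M_1^{n_1,\dots,n_D}\times\dots\times\mathcal M_R^{n_1,\dots,n_D}\to\mathbb R^{n_1\times\dots\times n_D}$ be the addition map and $a=(\mathcal A_1,\dots,\mathcal A_R)$. If $\Sigma$ has a continuous local inverse $\Sigma_a^{-1}$, defined on the image $\mathcal I$ under $\Sigma$ of a neighbourhood of $a$, then $$\kappa^{\mathrm{SBTD}}(\mathcal A_1,\dots,\mathcal A_R)=\lim_{\delta\to0}\ \sup_{\widetilde{\mathcal A}\in\mathcal I,\ 0<\|\mathcal A-\widetilde{\mathcal A}\|\le\delta}\frac{\|\Sigma_a^{-1}(\mathcal A)-\Sigma_a^{-1}(\widetilde{\mathcal A})\|}{\|\mathcal A-\widetilde{\mathcal A}\|},$$ with the supremum of the empty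 set equal to $0$; if there is no such local inverse, it is $\infty$. $\kappa^{\mathrm{BTD}}$ is the same quantity for $\mathcal N_1,\dots,\mathcal N_R$ in place of $\mathcal M_1,\dots,\mathcal M_R$. **Proposition.** The given SBTD of $\mathcal A$ is also a BTD of $\mathcal A$, i.e. $\mathcal A_r\in\mathcal N_r^{n_1,\dots,n_D}$ for all $r$, and $$\kappa^{\mathrm{BTD}}(\mathcal A_1,\dots,\mathcal A_R)\ \ge\ \kappa^{\mathrm{SBTD}}(\mathcal A_1,\dots,\mathcal A_R).$$ Suppose moreover that the terms $\mathcal A_r=(U_1^r,\dots,U_D^r)\cdot\mathcal C_r$ are in compact HOSVD form: for all $r$ and $d$, the $l^r_d$ columns of $U^r_d\in\mathbb R^{n_d\times l_d^r}$ are an orthonormal system of left singular vectors for all the nonzero singular values, with multiplicity, of the $d$-th unfolding of $\mathcal A_r$. Then $$\kappa^{\mathrm{BTD}}(\mathcal A_1,\dots,\mathcal A_R)\ \ge\ \sigma_{\min}\left(\left[U_1^r\otimes\dots\otimes U_D^r\right]_{r=1}^R\right)^{-1},$$ where $\sigma_{\min}(B)=\sigma_{\min\{p,q\}}(B)$ is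 the smallest singular value of a $p\times q$ matrix $B$, and $0^{-1}=\infty$. Moreover, in this case $\kappa^{\mathrm{BTD}}(\mathcal A_1,\dots,\mathcal A_R)=\infty$ if $[U_1^r\otimes\dots\otimes U_D^r]_{r=1}^R$ has a nontrivial kernel. -/

import Mathlib

open scoped ENNReal Topology ContDiff Matrix

noncomputable section

namespace StructuredTucker

/-! ## Tensors and multilinear multiplication -/

/-- Real tensors of format `n 0 × ⋯ × n (D - 1)`, with the Euclidean (Frobenius) norm. -/
abbrev Tensor {D : ℕ} (n : Fin D → ℕ) : Type :=
  EuclideanSpace ℝ (∀ d, Fin (n d))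

/-- The matrix `U 0 ⊗ ⋯ ⊗ U (D - 1)`, with rows and columns indexed by multi-indices. -/
def tensorMatrix {D : ℕ} {n l : Fin D → ℕ} (U : ∀ d, Matrix (Fin (n d)) (Fin (l d)) ℝ) :
    Matrix (∀ d, Fin (n d)) (∀ d, Fin (l d)) ℝ :=
  Matrix.of fun i j => ∏ d, U d (i d) (j d)

/-- Multilinear multiplication `(U 0, …, U (D - 1)) · C`. -/
def multilinMul {D : ℕ} {n l : Fin D → ℕ} (U : ∀ d, Matrix (Fin (n d)) (Fin (l d)) ℝ)
    (C : Tensor l) : Tensor n :=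
  WithLp.toLp 2 fun i => ∑ j, (∏ d, U d (i d) (j d)) * C j

/-- The `d`-th unfolding (flattening) of a tensor: rows are indexed by the `d`-th index and columns
by all the other indices. -/
def unfold {D : ℕ} {n : Fin D → ℕ} (d : Fin D) (A : Tensor n) :
    Matrix (Fin (n d)) (∀ e : {e // e ≠ d}, Fin (n e)) ℝ :=
  Matrix.of fun i j => A ((Equiv.piSplitAt d fun e => Fin (n e)).symm (i, j))

/-- `A` has multilinear rank `k`. -/
def HasMultilinearRank {D : ℕ} {n : Fin D → ℕ} (A : Tensor n) (k : Fin D → ℕ) : Prop :=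
  ∀ d, (unfold d A).rank = k d

/-! ## Tucker core structures and structured Tucker manifolds -/

/-- `M` is a smooth embedded submanifold of the finite-dimensional space `E`: for some `k`, around
each of its points there is a smooth chart of `E` that straightens `M` to a `k`-dimensional linear
subspace (slice charts). -/
def IsSmoothSubmanifold {E : Type*} [NormedAddCommGroup E] [NormedSpace ℝ E] (M : Set E) : Prop :=
  ∃ k : ℕ, ∀ p ∈ M, ∃ (e : OpenPartialHomeomorph E E) (W : Submodule ℝ E),
    p ∈ e.source ∧ Module.finrank ℝ W = k ∧
    ContDiffOn ℝ ∞ e e.source ∧ ContDiffOn ℝ ∞ e.symm e.target ∧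
    ∀ x ∈ e.source, x ∈ M ↔ e x ∈ W

/-- Tucker core structures: smooth submanifolds of `ℝ^(l 0 × ⋯ × l (D - 1))` whose elements all
have multilinear rank `l`, and which are invariant under `GL(l 0) × ⋯ × GL(l (D - 1))`. -/
structure IsTuckerCoreStructure {D : ℕ} {l : Fin D → ℕ} (M : Set (Tensor l)) : Prop where
  submanifold : IsSmoothSubmanifold M
  multilinearRank : ∀ C ∈ M, HasMultilinearRank C l
  invariant : ∀ C ∈ M, ∀ G : ∀ d, GL (Fin (l d)) ℝ,
    multilinMul (fun d => (G d : Matrix (Fin (l d)) (Fin (l d)) ℝ)) C ∈ M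

/-- The `M`-structured Tucker manifold in `ℝ^(n 0 × ⋯ × n (D - 1))`: all tensors
`(U 0, …, U (D - 1)) · C` with `C ∈ M` and matrices `U d` of full column rank. -/
def structuredTucker {D : ℕ} (n : Fin D → ℕ) {l : Fin D → ℕ} (M : Set (Tensor l)) :
    Set (Tensor n) :=
  {A | ∃ C ∈ M, ∃ U : ∀ d, Matrix (Fin (n d)) (Fin (l d)) ℝ,
    (∀ d, (U d).rank = l d) ∧ A = multilinMul U C}

/-- The Tucker core structure of block term decompositions: all tensors in
`ℝ^(l 0 × ⋯ × l (D - 1))` of multilinear rank `l`. -/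
def fullRankCores {D : ℕ} (l : Fin D → ℕ) : Set (Tensor l) :=
  {C | HasMultilinearRank C l}

/-! `fullRankCores l` is a Tucker core structure. -/

theorem multilinMul_mul {D : ℕ} {n l k : Fin D → ℕ} (U : ∀ d, Matrix (Fin (n d)) (Fin (l d)) ℝ)
    (V : ∀ d, Matrix (Fin (l d)) (Fin (k d)) ℝ) (C : Tensor k) :
    multilinMul U (multilinMul V C) = multilinMul (fun d => U d * V d) C := by
  ext i
  simp only [multilinMul, Matrix.mul_apply, Finset.mul_sum, Finset.prod_univ_sum,
    Fintype.piFinset_univ, Finset.sum_mul]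
  rw [Finset.sum_comm]
  refine Finset.sum_congr rfl fun x _ => Finset.sum_congr rfl fun y _ => ?_
  rw [Finset.prod_mul_distrib, mul_assoc]

theorem multilinMul_one {D : ℕ} {n : Fin D → ℕ} (C : Tensor n) :
    multilinMul (fun d => (1 : Matrix (Fin (n d)) (Fin (n d)) ℝ)) C = C := by
  ext i
  simp only [multilinMul]
  rw [Finset.sum_eq_single i]
  · simp
  · intro j _ hj
    obtain ⟨d, hd⟩ := Function.ne_iff.1 hj
    have h0 : (1 : Matrix (Fin (n d)) (Fin (n d)) ℝ) (i d) (j d) = 0 := Matrix.one_apply_ne (Ne.symm hd)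
    rw [Finset.prod_eq_zero (Finset.mem_univ d) h0, zero_mul]
  · simp

theorem unfold_multilinMul {D : ℕ} {n l : Fin D → ℕ}
    (U : ∀ d, Matrix (Fin (n d)) (Fin (l d)) ℝ) (C : Tensor l) (d : Fin D) :
    unfold d (multilinMul U C) = U d * (unfold d C *
      Matrix.of fun (j : ∀ e : {e // e ≠ d}, Fin (l e)) (i : ∀ e : {e // e ≠ d}, Fin (n e)) =>
        ∏ e : {e // e ≠ d}, U e (i e) (j e)) := by
  ext i j
  simp only [unfold, multilinMul, Matrix.mul_apply, Matrix.of_apply, Finset.mul_sum]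
  rw [← (Equiv.piSplitAt d fun e => Fin (l e)).symm.sum_comp, Fintype.sum_prod_type]
  refine Finset.sum_congr rfl fun x _ => Finset.sum_congr rfl fun y _ => ?_
  rw [← Fintype.prod_subtype_mul_prod_subtype (fun e => e = d)]
  simp only [Fintype.prod_unique]
  have h1 : ∀ (q : Fin D → ℕ) (x : Fin (q d)) (y : ∀ e : {e // e ≠ d}, Fin (q e)),
      (Equiv.piSplitAt d fun e => Fin (q e)).symm (x, y) d = x := by
    intro q x y; simp [Equiv.piSplitAt]
  have h2 : ∀ (q : Fin D → ℕ) (x : Fin (q d)) (y : ∀ e : {e // e ≠ d}, Fin (q e))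
      (e : {e // e ≠ d}), (Equiv.piSplitAt d fun e => Fin (q e)).symm (x, y) e = y e := by
    intro q x y e; simp [Equiv.piSplitAt, e.2]
  have h3 : ((default : {e // e = d}) : Fin D) = d := rfl
  rw [h3, h1, h1, mul_assoc, mul_comm (∏ _, _)]
  congr 2
  refine Finset.prod_congr rfl fun e _ => ?_
  rw [h2, h2]

theorem rank_unfold_multilinMul_le {D : ℕ} {n l : Fin D → ℕ}
    (U : ∀ d, Matrix (Fin (n d)) (Fin (l d)) ℝ) (C : Tensor l) (d : Fin D) :
    (unfold d (multilinMul U C)).rank ≤ (unfold d C).rank := by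
  rw [unfold_multilinMul]
  exact (Matrix.rank_mul_le_right _ _).trans (Matrix.rank_mul_le_left _ _)

theorem rank_eq_iff_det {m : ℕ} {q : Type*} [Fintype q] (B : Matrix (Fin m) q ℝ) :
    B.rank = m ↔ (B * Bᵀ).det ≠ 0 := by
  rw [← Matrix.rank_self_mul_transpose]
  constructor
  · intro h h0
    have : ¬ LinearIndependent ℝ (B * Bᵀ).row := by
      rw [Matrix.linearIndependent_rows_iff_isUnit, Matrix.isUnit_iff_isUnit_det, h0]; simp
    apply this
    have h2 := Matrix.rank_eq_finrank_span_row (B * Bᵀ)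
    rw [h] at h2
    rw [linearIndependent_iff_card_eq_finrank_span, Fintype.card_fin]
    exact h2
  · intro h
    have := Matrix.rank_of_isUnit (B * Bᵀ) ((Matrix.isUnit_iff_isUnit_det _).2 h.isUnit)
    simpa using this

theorem isTuckerCoreStructure_fullRankCores {D : ℕ} (l : Fin D → ℕ) :
    IsTuckerCoreStructure (fullRankCores l) where
  submanifold := by
    have ho : IsOpen (fullRankCores l) := by
      have : fullRankCores l = ⋂ d, {C | (unfold d C * (unfold d C)ᵀ).det ≠ 0} := by
        ext C
        simp only [fullRankCores, HasMultilinearRank, Set.mem_ofPred_eq, Set.mem_iInter,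
          rank_eq_iff_det]
      rw [this]
      refine isOpen_iInter_of_finite fun d => ?_
      have hu : Continuous fun C : Tensor l => unfold d C := by
        refine continuous_matrix fun i j => ?_
        simp only [unfold, Matrix.of_apply]
        fun_prop
      exact isOpen_ne_fun (hu.matrix_mul hu.matrix_transpose).matrix_det continuous_const
    refine ⟨Module.finrank ℝ (Tensor l), fun p hp =>
      ⟨OpenPartialHomeomorph.ofSet _ ho, ⊤, hp, finrank_top _ _, ?_, ?_, ?_⟩⟩
    · exact contDiff_id.contDiffOn
    · exact contDiff_id.contDiffOn
    · intro x hx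
      exact ⟨fun _ => trivial, fun _ => hx⟩
  multilinearRank := fun _ h => h
  invariant := by
    intro C hC G d
    refine le_antisymm ((rank_unfold_multilinMul_le _ C d).trans (hC d).le) ?_
    have h := rank_unfold_multilinMul_le (fun d => ((G d)⁻¹ : GL (Fin (l d)) ℝ).1)
      (multilinMul (fun d => (G d).1) C) d
    rw [multilinMul_mul] at h
    simp only [Units.inv_mul, multilinMul_one] at h
    rwa [hC d] at h

/-! ## Condition numbers -/

section Condition

variable {X Y : Type*} [NormedAddCommGroup X] [NormedAddCommGroup Y]

/-- `g` is a local inverse at `a` of the restriction of `f` to `P`: it is a continuous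
inverse of `f` on `f '' V`, where `V` is a neighbourhood of `a` in `P`. -/
structure IsLocalInverse (f : X → Y) (P : Set X) (a : X) (V : Set X) (g : Y → X) : Prop where
  subset : V ⊆ P
  mem_nhdsWithin : V ∈ 𝓝[P] a
  leftInvOn : Set.LeftInvOn g f V
  continuousOn : ContinuousOn g (f '' V)

/-- The supremum of `‖g (f a) - g y‖ / ‖f a - y‖` over the `y ≠ f a` in `I` at distance at most `δ`
from `f a`. -/
def errorRatio (f : X → Y) (a : X) (I : Set Y) (g : Y → X) (δ : ℝ) : ℝ≥0∞ :=
  ⨆ y ∈ {y | y ∈ I ∧ y ≠ f a ∧ ‖f a - y‖ ≤ δ}, ENNReal.ofReal (‖g (f a) - g y‖ / ‖f a - y‖)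

/-- The limit of `errorRatio` as `δ` decreases to `0`; it is an infimum because `errorRatio` is
monotone in `δ`, see `tendsto_errorRatio`. -/
def condLimit (f : X → Y) (a : X) (I : Set Y) (g : Y → X) : ℝ≥0∞ :=
  ⨅ δ : {δ : ℝ // 0 < δ}, errorRatio f a I g δ

/-- The condition number at `a` of inverting the restriction of `f` to `P`: it is
`condLimit f a (f '' V) g` for any local inverse `g` of `f` on `f '' V` (the value does not depend
on the local inverse, see `condNumber_eq`), and `∞` if there is no local inverse. -/
def condNumber (f : X → Y) (P : Set X) (a : X) : ℝ≥0∞ :=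
  ⨅ (V : Set X) (g : Y → X) (_ : IsLocalInverse f P a V g), condLimit f a (f '' V) g

theorem errorRatio_mono (f : X → Y) (a : X) (I : Set Y) (g : Y → X) :
    Monotone (errorRatio f a I g) := by
  intro δ ε h
  refine biSup_mono ?_
  rintro y ⟨h1, h2, h3⟩
  exact ⟨h1, h2, h3.trans h⟩

theorem tendsto_errorRatio (f : X → Y) (a : X) (I : Set Y) (g : Y → X) :
    Filter.Tendsto (errorRatio f a I g) (𝓝[>] 0) (𝓝 (condLimit f a I g)) := by
  have h := (errorRatio_mono f a I g).tendsto_nhdsGT 0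
  rwa [sInf_image'] at h

theorem condLimit_le {f : X → Y} {P : Set X} {a : X} {V W : Set X} {g h : Y → X} (ha : a ∈ P)
    (hg : IsLocalInverse f P a V g) (hh : IsLocalInverse f P a W h) :
    condLimit f a (f '' V) g ≤ condLimit f a (f '' W) h := by
  have haV : a ∈ V := mem_of_mem_nhdsWithin ha hg.mem_nhdsWithin
  have haW : a ∈ W := mem_of_mem_nhdsWithin ha hh.mem_nhdsWithin
  refine le_iInf fun ε => ?_
  obtain ⟨u, hu, hau, hsub⟩ := mem_nhdsWithin.1 hh.mem_nhdsWithin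
  have hc : u ∈ 𝓝 (g (f a)) := by rw [hg.leftInvOn haV]; exact hu.mem_nhds hau
  have hpre := hg.continuousOn (f a) ⟨a, haV, rfl⟩ hc
  obtain ⟨η, hη, hball⟩ := Metric.mem_nhdsWithin_iff.1 hpre
  refine (iInf_le _ ⟨min ε (η / 2), lt_min ε.2 (half_pos hη)⟩).trans ?_
  refine iSup₂_le ?_
  rintro _ ⟨⟨x, hx, rfl⟩, hne, hle⟩
  have hxu : x ∈ u := by
    have : f x ∈ Metric.ball (f a) η ∩ f '' V := by
      refine ⟨?_, x, hx, rfl⟩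
      rw [Metric.mem_ball, dist_comm, dist_eq_norm]
      have := hle.trans (min_le_right _ _)
      linarith
    have := hball this
    rwa [Set.mem_preimage, hg.leftInvOn hx] at this
  have hxW : x ∈ W := hsub ⟨hxu, hg.subset hx⟩
  rw [hg.leftInvOn haV, hg.leftInvOn hx]
  refine le_trans (le_of_eq ?_)
    (le_iSup₂_of_le (f x) ⟨⟨x, hxW, rfl⟩, hne, hle.trans (min_le_left _ _)⟩ le_rfl)
  rw [hh.leftInvOn haW, hh.leftInvOn hxW]

theorem condNumber_eq {f : X → Y} {P : Set X} {a : X} {V : Set X} {g : Y → X} (ha : a ∈ P)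
    (hg : IsLocalInverse f P a V g) : condNumber f P a = condLimit f a (f '' V) g :=
  le_antisymm (iInf_le_of_le V (iInf_le_of_le g (iInf_le _ hg)))
    (le_iInf fun _ => le_iInf fun _ => le_iInf fun hh => condLimit_le ha hg hh)

theorem condNumber_eq_top {f : X → Y} {P : Set X} {a : X}
    (h : ¬ ∃ V g, IsLocalInverse f P a V g) : condNumber f P a = ⊤ := by
  simp only [condNumber, iInf_eq_top]
  exact fun V g hg => (h ⟨V, g, hg⟩).elim

end Condition

/-- The addition map `(A_1, …, A_R) ↦ A_1 + ⋯ + A_R`; the domain carries the product Euclidean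
norm. -/
def additionMap {D R : ℕ} (n : Fin D → ℕ) (A : PiLp 2 fun _ : Fin R => Tensor n) : Tensor n :=
  ∑ r, A r

/-- The condition number of the structured block term decomposition `A_1 + ⋯ + A_R` with core
structures `M_1, …, M_R`. -/
def kappaSBTD {D R : ℕ} (n : Fin D → ℕ) {l : Fin R → Fin D → ℕ} (M : ∀ r, Set (Tensor (l r)))
    (A : PiLp 2 fun _ : Fin R => Tensor n) : ℝ≥0∞ :=
  condNumber (additionMap n) {B | ∀ r, B r ∈ structuredTucker n (M r)} A

/-- The condition number of the block term decomposition `A_1 + ⋯ + A_R` whose `r`-th term has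
multilinear rank `l r`. -/
def kappaBTD {D R : ℕ} (n : Fin D → ℕ) (l : Fin R → Fin D → ℕ)
    (A : PiLp 2 fun _ : Fin R => Tensor n) : ℝ≥0∞ :=
  kappaSBTD n (fun r => fullRankCores (l r)) A

/-! ## HOSVD form and smallest singular values -/

/-- `A = (U 0, …, U (D - 1)) · C` is a compact higher-order singular value decomposition: for each
`d` the columns of `U d` are orthonormal left singular vectors of the `d`-th unfolding of `A`
belonging to all of its nonzero singular values, that is, the unfolding has a compact singular value
decomposition `U d * diag σ * Vᵀ` with all `σ j > 0`. -/
def IsHOSVD {D : ℕ} {n l : Fin D → ℕ} (A : Tensor n)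
    (U : ∀ d, Matrix (Fin (n d)) (Fin (l d)) ℝ) (C : Tensor l) : Prop :=
  A = multilinMul U C ∧
  ∀ d, (U d)ᵀ * U d = 1 ∧
    ∃ (σ : Fin (l d) → ℝ) (V : Matrix (∀ e : {e // e ≠ d}, Fin (n e)) (Fin (l d)) ℝ),
      (∀ j, 0 < σ j) ∧ Vᵀ * V = 1 ∧ unfold d A = U d * Matrix.diagonal σ * Vᵀ

/-- The block matrix `[U_1^r ⊗ ⋯ ⊗ U_D^r]_{r = 1}^R`. -/
def blockMatrix {D R : ℕ} {n : Fin D → ℕ} {l : Fin R → Fin D → ℕ}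
    (U : ∀ r d, Matrix (Fin (n d)) (Fin (l r d)) ℝ) :
    Matrix (∀ d, Fin (n d)) (Σ r, ∀ d, Fin (l r d)) ℝ :=
  Matrix.of fun i j => tensorMatrix (U j.1) i j.2

/-- The smallest singular value `σ_min(A) = σ_{min(p, q)}(A)` of a `p × q` matrix. Mathlib numbers
the singular values in decreasing order starting from `0`. -/
def sigmaMin {p q : Type*} [Fintype p] [Fintype q] [DecidableEq q] (A : Matrix p q ℝ) : ℝ :=
  (Matrix.toEuclideanLin A).singularValues (min (Fintype.card p) (Fintype.card q) - 1)

end StructuredTucker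

end

namespace StructuredTucker

/-! ### Condition numbers: dependence on the domain, and lower bounds from segments in it -/

section Condition

variable {X Y : Type*} [NormedAddCommGroup X] [NormedAddCommGroup Y]

/-! Elements of a Tucker core structure have full multilinear rank, so the SBTD domain lies inside
the BTD domain. Restricting the domain keeps every local inverse and takes the supremum over fewer
points, hence the first inequality (`condNumber_mono`).

For the lower bound no tangent spaces are needed. Cores of full multilinear rank form an open set,
so with the HOSVD factors fixed the cores can be moved a little in any direction `X`. The BTD domain
thus contains a straight segment through `A` in the direction `blockTuple U X`, whose norm is `‖X‖`
because the factors have orthonormal columns. Addition is affine along this segment with velocity `B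
X`, where `B` is the block matrix. If `B X = 0` with `X ≠ 0`, addition is not locally injective
(`condNumber_eq_top_of_segment`). Otherwise the condition number is at least `‖X‖ / ‖B X‖`
(`le_condNumber_of_segment`), and a right singular vector for `sigmaMin B` gives the bound. -/

theorem IsLocalInverse.mono {f : X → Y} {P Q : Set X} {a : X} {V : Set X} {g : Y → X}
    (h : IsLocalInverse f P a V g) (hQ : Q ⊆ P) : IsLocalInverse f Q a (V ∩ Q) g where
  subset := Set.inter_subset_right
  mem_nhdsWithin :=
    Filter.inter_mem (nhdsWithin_mono a hQ h.mem_nhdsWithin) self_mem_nhdsWithin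
  leftInvOn := h.leftInvOn.mono Set.inter_subset_left
  continuousOn := h.continuousOn.mono (Set.image_mono Set.inter_subset_left)

theorem condLimit_mono (f : X → Y) (a : X) {I J : Set Y} (h : I ⊆ J) (g : Y → X) :
    condLimit f a I g ≤ condLimit f a J g :=
  iInf_mono fun _ => biSup_mono fun _ hy => ⟨h hy.1, hy.2⟩

/-- The condition number does not increase when the domain of the map shrinks. -/
theorem condNumber_mono (f : X → Y) {P Q : Set X} (hQ : Q ⊆ P) (a : X) :
    condNumber f Q a ≤ condNumber f P a :=
  le_iInf fun V => le_iInf fun g => le_iInf fun h =>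
    iInf_le_of_le (V ∩ Q) <| iInf_le_of_le g <| iInf_le_of_le (h.mono hQ) <|
      condLimit_mono f a (Set.image_mono Set.inter_subset_left) g

variable [NormedSpace ℝ X]

theorem eventually_add_smul_mem {P V : Set X} {a y : X}
    (hP : ∀ᶠ t : ℝ in 𝓝 0, a + t • y ∈ P) (hV : V ∈ 𝓝[P] a) :
    ∀ᶠ t : ℝ in 𝓝 0, a + t • y ∈ V := by
  have hc : Filter.Tendsto (fun t : ℝ => a + t • y) (𝓝 0) (𝓝 a) := by
    have : Continuous fun t : ℝ => a + t • y := by fun_prop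
    simpa using this.tendsto 0
  exact tendsto_nhdsWithin_iff.2 ⟨hc, hP⟩ hV

/-- A map that is constant on a segment of its domain through `a` has no local inverse at `a`. -/
theorem condNumber_eq_top_of_segment {f : X → Y} {P : Set X} {a y : X} (ha : a ∈ P) (hy : y ≠ 0)
    (hP : ∀ᶠ t : ℝ in 𝓝 0, a + t • y ∈ P) (hf : ∀ t : ℝ, f (a + t • y) = f a) :
    condNumber f P a = ⊤ := by
  refine condNumber_eq_top ?_
  rintro ⟨V, g, h⟩
  have haV : a ∈ V := mem_of_mem_nhdsWithin ha h.mem_nhdsWithin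
  have hV : ∀ᶠ t : ℝ in 𝓝[≠] 0, a + t • y ∈ V :=
    nhdsWithin_le_nhds (eventually_add_smul_mem hP h.mem_nhdsWithin)
  -- A small nonzero `t` gives a second point of `V` with the same image as `a`, against injectivity
  -- on `V`.
  obtain ⟨t, htV, ht⟩ := (hV.and self_mem_nhdsWithin).exists
  have h1 := h.leftInvOn htV
  rw [hf, h.leftInvOn haV] at h1
  exact smul_ne_zero ht hy (left_eq_add.1 h1)

/-- If `f` maps the direction `y`, along which the domain contains a segment through `a`, to `z`,
then the condition number is at least `‖y‖ / ‖z‖`. -/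
theorem le_condNumber_of_segment [NormedSpace ℝ Y] {f : X → Y} {P : Set X} {a y : X} {z : Y} (ha : a ∈ P)
    (hz : z ≠ 0) (hP : ∀ᶠ t : ℝ in 𝓝 0, a + t • y ∈ P)
    (hf : ∀ t : ℝ, f (a + t • y) = f a + t • z) :
    ENNReal.ofReal (‖y‖ / ‖z‖) ≤ condNumber f P a := by
  -- If there is no local inverse, the infimum is `⊤`, so that case needs no separate treatment.
  refine le_iInf fun V => le_iInf fun g => le_iInf fun h => le_iInf fun δ => ?_
  have haV : a ∈ V := mem_of_mem_nhdsWithin ha h.mem_nhdsWithin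
  have hδ : ∀ᶠ t : ℝ in 𝓝 0, ‖t • z‖ < δ := by
    have : Continuous fun t : ℝ => ‖t • z‖ := by fun_prop
    exact this.continuousAt.eventually_lt continuousAt_const (by simpa using δ.2)
  have hV : ∀ᶠ t : ℝ in 𝓝[≠] 0, a + t • y ∈ V ∧ ‖t • z‖ < δ :=
    nhdsWithin_le_nhds ((eventually_add_smul_mem hP h.mem_nhdsWithin).and hδ)
  obtain ⟨t, ⟨htV, htδ⟩, ht⟩ := (hV.and self_mem_nhdsWithin).exists
  have hdist : ‖f a - f (a + t • y)‖ = ‖t • z‖ := by rw [hf, sub_add_cancel_left, norm_neg]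
  refine le_iSup₂_of_le (f (a + t • y)) ⟨⟨_, htV, rfl⟩, ?_, hdist.trans_le htδ.le⟩ ?_
  · rw [hf]
    simpa using ⟨ht, hz⟩
  -- The factor `‖t‖` cancels: the quotient is `‖y‖ / ‖z‖` at every scale, so the bound survives the
  -- limit in `δ`.
  · rw [hdist, h.leftInvOn haV, h.leftInvOn htV, sub_add_cancel_left, norm_neg, norm_smul,
      norm_smul, mul_div_mul_left _ _ (norm_ne_zero_iff.2 ht)]

end Condition

/-! ## Smallest singular values -/

/-- Every singular value whose index is below the dimension of the domain is attained. -/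
theorem exists_norm_map_eq_singularValues {E F : Type*}
    [NormedAddCommGroup E] [InnerProductSpace ℝ E] [FiniteDimensional ℝ E]
    [NormedAddCommGroup F] [InnerProductSpace ℝ F] [FiniteDimensional ℝ F]
    (T : E →ₗ[ℝ] F) {i : ℕ} (hi : i < Module.finrank ℝ E) :
    ∃ x, x ≠ 0 ∧ ‖T x‖ = T.singularValues i * ‖x‖ := by
  obtain ⟨x, hx⟩ := (T.hasEigenvalue_adjoint_comp_self_sq_singularValues hi).exists_hasEigenvector
  refine ⟨x, hx.2, ?_⟩
  -- `x` is an eigenvector of `T* T` for the squared singular value, and `‖T x‖² = ⟪T* T x, x⟫`.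
  have h : ‖T x‖ ^ 2 = (T.singularValues i * ‖x‖) ^ 2 := by
    rw [← real_inner_self_eq_norm_sq, ← LinearMap.adjoint_inner_left,
      ← LinearMap.comp_apply, hx.apply_eq_smul, real_inner_smul_left, real_inner_self_eq_norm_sq,
      mul_pow]
    rfl
  exact (sq_eq_sq₀ (norm_nonneg _)
    (mul_nonneg (T.singularValues_nonneg i) (norm_nonneg _))).1 h

theorem exists_norm_map_eq_sigmaMin {p q : Type*} [Fintype p] [Fintype q] [DecidableEq q]
    [Nonempty q] (B : Matrix p q ℝ) :
    ∃ x, x ≠ 0 ∧ ‖Matrix.toEuclideanLin B x‖ = sigmaMin B * ‖x‖ := by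
  refine exists_norm_map_eq_singularValues _ ?_
  rw [finrank_euclideanSpace]
  -- A nonempty `q` keeps the index `min - 1` below the dimension of the domain, even when `p` is
  -- empty and the subtraction truncates to `0`.
  have := Fintype.card_pos (α := q)
  omega

/-! ## Multilinear multiplication by matrices with orthonormal columns -/

section Orthonormal

variable {D : ℕ} {n l : Fin D → ℕ}

/-- An unfolding has full row rank exactly when its Gram determinant is nonzero, an open condition.
This is what lets a BTD core move in every direction. -/
theorem isOpen_fullRankCores (l : Fin D → ℕ) : IsOpen (fullRankCores l) := by
  have h : fullRankCores l = ⋂ d, {C | (unfold d C * (unfold d C)ᵀ).det ≠ 0} := by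
    ext C
    simp only [fullRankCores, HasMultilinearRank, Set.mem_ofPred_eq, Set.mem_iInter,
      rank_eq_iff_det]
  rw [h]
  refine isOpen_iInter_of_finite fun d => ?_
  have hu : Continuous fun C : Tensor l => unfold d C := by
    refine continuous_matrix fun i j => ?_
    simp only [unfold, Matrix.of_apply]
    fun_prop
  exact isOpen_ne_fun (hu.matrix_mul hu.matrix_transpose).matrix_det continuous_const

theorem multilinMul_eq_mulVec (U : ∀ d, Matrix (Fin (n d)) (Fin (l d)) ℝ) (C : Tensor l) :
    multilinMul U C = Matrix.toEuclideanLin (tensorMatrix U) C := rfl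

theorem multilinMul_add_smul (U : ∀ d, Matrix (Fin (n d)) (Fin (l d)) ℝ) (C X : Tensor l)
    (t : ℝ) : multilinMul U (C + t • X) = multilinMul U C + t • multilinMul U X := by
  simp only [multilinMul_eq_mulVec, map_add, map_smul]

/-- The adjoint of `U 0 ⊗ ⋯ ⊗ U (D - 1)` is the tensor product of the transposes, so the adjoint
composed with the map is the tensor product of the `(U d)ᵀ * U d`, the identity. -/
theorem norm_multilinMul {U : ∀ d, Matrix (Fin (n d)) (Fin (l d)) ℝ}
    (hU : ∀ d, (U d)ᵀ * U d = 1) (C : Tensor l) : ‖multilinMul U C‖ = ‖C‖ := by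
  have hT : (tensorMatrix U)ᴴ = tensorMatrix fun d => (U d)ᵀ := by
    ext i j
    simp [tensorMatrix]
  have h : ‖multilinMul U C‖ ^ 2 = ‖C‖ ^ 2 := by
    rw [← real_inner_self_eq_norm_sq, multilinMul_eq_mulVec, ← LinearMap.adjoint_inner_left,
      ← Matrix.toEuclideanLin_conjTranspose_eq_adjoint, hT, ← multilinMul_eq_mulVec,
      ← multilinMul_eq_mulVec, multilinMul_mul]
    simp only [hU, multilinMul_one, real_inner_self_eq_norm_sq]
  exact (sq_eq_sq₀ (norm_nonneg _) (norm_nonneg _)).1 h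

theorem rank_eq_of_transpose_mul_self {m k : ℕ} {B : Matrix (Fin m) (Fin k) ℝ} (h : Bᵀ * B = 1) :
    B.rank = k := by
  rw [← Matrix.rank_transpose_mul_self, h, Matrix.rank_one, Fintype.card_fin]

/-- Compressing the unfolding of `A` by the singular vectors leaves the invertible `diagonal σ`, so
that unfolding has rank at least `l d`. The unfolding of `C` has no smaller rank, and it has only `l
d` rows. -/
theorem IsHOSVD.core_mem {A : Tensor n} {U : ∀ d, Matrix (Fin (n d)) (Fin (l d)) ℝ} {C : Tensor l}
    (h : IsHOSVD A U C) : C ∈ fullRankCores l := by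
  intro d
  obtain ⟨hU, σ, V, hσ, hV, hA⟩ := h.2 d
  refine le_antisymm ((Matrix.rank_le_card_height _).trans_eq (Fintype.card_fin _)) ?_
  have h1 : (unfold d A).rank ≤ (unfold d C).rank := h.1 ▸ rank_unfold_multilinMul_le U C d
  have h2 : (U d)ᵀ * unfold d A * V = Matrix.diagonal σ := by
    rw [hA]
    simp only [Matrix.mul_assoc, hV, Matrix.mul_one]
    rw [← Matrix.mul_assoc, hU, Matrix.one_mul]
  have h3 : (Matrix.diagonal σ).rank = l d := by
    rw [Matrix.rank_of_isUnit, Fintype.card_fin]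
    rw [Matrix.isUnit_iff_isUnit_det, Matrix.det_diagonal]
    exact (Finset.prod_ne_zero_iff.2 fun j _ => (hσ j).ne').isUnit
  calc l d = ((U d)ᵀ * unfold d A * V).rank := by rw [h2, h3]
    _ ≤ (unfold d A).rank := (Matrix.rank_mul_le_left _ _).trans (Matrix.rank_mul_le_right _ _)
    _ ≤ _ := h1

/-- Only the core moves, from `C` to `C + t • X`; the factors stay fixed. -/
theorem IsHOSVD.eventually_mem {A : Tensor n} {U : ∀ d, Matrix (Fin (n d)) (Fin (l d)) ℝ}
    {C : Tensor l} (h : IsHOSVD A U C) (X : Tensor l) :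
    ∀ᶠ t : ℝ in 𝓝 0, A + t • multilinMul U X ∈ structuredTucker n (fullRankCores l) := by
  have hc : Continuous fun t : ℝ => C + t • X := by fun_prop
  have ho : ∀ᶠ t : ℝ in 𝓝 0, C + t • X ∈ fullRankCores l :=
    hc.continuousAt.eventually_mem ((isOpen_fullRankCores l).mem_nhds (by simpa using h.core_mem))
  filter_upwards [ho] with t ht
  refine ⟨_, ht, U, fun d => rank_eq_of_transpose_mul_self (h.2 d).1, ?_⟩
  rw [multilinMul_add_smul, ← h.1]

end Orthonormal

/-! ## Block term decompositions -/

section Block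

variable {D R : ℕ} {n : Fin D → ℕ} {l : Fin R → Fin D → ℕ}

theorem structuredTucker_mono (n : Fin D → ℕ) {k : Fin D → ℕ} {M N : Set (Tensor k)} (h : M ⊆ N) :
    structuredTucker n M ⊆ structuredTucker n N :=
  fun _ ⟨C, hC, hA⟩ => ⟨C, h hC, hA⟩

/-- The `R`-tuple of tensors `(U_1^r, …, U_D^r) · X_r`, for the blocks `X_r` of the vector `X`. -/
def blockTuple (U : ∀ r d, Matrix (Fin (n d)) (Fin (l r d)) ℝ)
    (X : EuclideanSpace ℝ (Σ r, ∀ d, Fin (l r d))) : PiLp 2 fun _ : Fin R => Tensor n :=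
  WithLp.toLp 2 fun r => multilinMul (U r) (WithLp.toLp 2 fun j => X ⟨r, j⟩)

theorem norm_blockTuple {U : ∀ r d, Matrix (Fin (n d)) (Fin (l r d)) ℝ}
    (hU : ∀ r d, (U r d)ᵀ * U r d = 1) (X : EuclideanSpace ℝ (Σ r, ∀ d, Fin (l r d))) :
    ‖blockTuple U X‖ = ‖X‖ := by
  refine (sq_eq_sq₀ (norm_nonneg _) (norm_nonneg _)).1 ?_
  rw [PiLp.norm_sq_eq_of_L2, EuclideanSpace.norm_sq_eq, Fintype.sum_sigma]
  refine Finset.sum_congr rfl fun r _ => ?_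
  simp only [blockTuple, norm_multilinMul (hU r), EuclideanSpace.norm_sq_eq]

theorem additionMap_add_smul_blockTuple (A : PiLp 2 fun _ : Fin R => Tensor n)
    (U : ∀ r d, Matrix (Fin (n d)) (Fin (l r d)) ℝ)
    (X : EuclideanSpace ℝ (Σ r, ∀ d, Fin (l r d))) (t : ℝ) :
    additionMap n (A + t • blockTuple U X) =
      additionMap n A + t • Matrix.toEuclideanLin (blockMatrix U) X := by
  have h : ∑ r, blockTuple U X r = Matrix.toEuclideanLin (blockMatrix U) X := by
    ext i
    simp [blockTuple, multilinMul, blockMatrix, tensorMatrix, Matrix.mulVec, dotProduct,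
      Fintype.sum_sigma]
  simp only [additionMap, PiLp.add_apply, PiLp.smul_apply, Finset.sum_add_distrib,
    ← Finset.smul_sum, h]

variable {A : PiLp 2 fun _ : Fin R => Tensor n} {U : ∀ r d, Matrix (Fin (n d)) (Fin (l r d)) ℝ}
  {C : ∀ r, Tensor (l r)}

theorem eventually_add_smul_blockTuple_mem (h : ∀ r, IsHOSVD (A r) (U r) (C r))
    (X : EuclideanSpace ℝ (Σ r, ∀ d, Fin (l r d))) :
    ∀ᶠ t : ℝ in 𝓝 0, A + t • blockTuple U X ∈
      {B : PiLp 2 fun _ : Fin R => Tensor n |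
        ∀ r, B r ∈ structuredTucker n (fullRankCores (l r))} :=
  Filter.eventually_all.2 fun r => (h r).eventually_mem _

theorem kappaBTD_eq_top (hA : ∀ r, A r ∈ structuredTucker n (fullRankCores (l r)))
    (h : ∀ r, IsHOSVD (A r) (U r) (C r))
    (hx : ∃ x, x ≠ 0 ∧ (blockMatrix U).mulVec x = 0) : kappaBTD n l A = ⊤ := by
  obtain ⟨x, hx0, hx⟩ := hx
  refine condNumber_eq_top_of_segment (y := blockTuple U (WithLp.toLp 2 x)) hA ?_
    (eventually_add_smul_blockTuple_mem h _) fun t => ?_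
  · rw [← norm_ne_zero_iff, norm_blockTuple fun r d => ((h r).2 d).1, norm_ne_zero_iff]
    simpa using hx0
  · rw [additionMap_add_smul_blockTuple, Matrix.toLpLin_apply, hx]
    simp

theorem inv_sigmaMin_le_kappaBTD (hR : 0 < R) (hl : ∀ r d, 0 < l r d)
    (hA : ∀ r, A r ∈ structuredTucker n (fullRankCores (l r)))
    (h : ∀ r, IsHOSVD (A r) (U r) (C r)) :
    (ENNReal.ofReal (sigmaMin (blockMatrix U)))⁻¹ ≤ kappaBTD n l A := by
  -- A matrix with more columns than rows can have a kernel although `sigmaMin` is positive, so the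
  -- split is on the kernel and not on whether `sigmaMin` vanishes.
  by_cases hx : ∃ x, x ≠ 0 ∧ (blockMatrix U).mulVec x = 0
  · exact le_top.trans_eq (kappaBTD_eq_top hA h hx).symm
  have : Nonempty (Σ r, ∀ d, Fin (l r d)) := ⟨⟨⟨0, hR⟩, fun d => ⟨0, hl _ d⟩⟩⟩
  obtain ⟨x, hx0, hσ⟩ := exists_norm_map_eq_sigmaMin (blockMatrix U)
  have hz : Matrix.toEuclideanLin (blockMatrix U) x ≠ 0 := fun h0 =>
    hx ⟨x.ofLp, by simpa using hx0, by simpa [Matrix.toLpLin_apply] using h0⟩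
  have hpos : 0 < ‖x‖ := norm_pos_iff.2 hx0
  -- With a trivial kernel, `B x ≠ 0` forces `sigmaMin` to be positive.
  have hs : 0 < sigmaMin (blockMatrix U) :=
    pos_of_mul_pos_left (hσ ▸ norm_pos_iff.2 hz) hpos.le
  refine le_trans (le_of_eq ?_) (le_condNumber_of_segment hA hz
    (eventually_add_smul_blockTuple_mem h x) (additionMap_add_smul_blockTuple A U x))
  rw [norm_blockTuple fun r d => ((h r).2 d).1, hσ, ← ENNReal.ofReal_inv_of_pos hs]
  congr 1
  field_simp

end Block

end StructuredTucker

theorem mainTheorem7 {D R : ℕ} (hR : 0 < R) (n : Fin D → ℕ) (l : Fin R → Fin D → ℕ)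
    (hl : ∀ r d, 0 < l r d)
    (M : ∀ r, Set (StructuredTucker.Tensor (l r)))
    (hM : ∀ r, StructuredTucker.IsTuckerCoreStructure (M r))
    (A : PiLp 2 fun _ : Fin R => StructuredTucker.Tensor n)
    (hA : ∀ r, A r ∈ StructuredTucker.structuredTucker n (M r)) :
    (∀ r, A r ∈ StructuredTucker.structuredTucker n (StructuredTucker.fullRankCores (l r))) ∧
    StructuredTucker.kappaSBTD n M A ≤ StructuredTucker.kappaBTD n l A ∧
    ∀ (U : ∀ r d, Matrix (Fin (n d)) (Fin (l r d)) ℝ) (C : ∀ r, StructuredTucker.Tensor (l r)),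
      (∀ r, StructuredTucker.IsHOSVD (A r) (U r) (C r)) →
        (ENNReal.ofReal (StructuredTucker.sigmaMin (StructuredTucker.blockMatrix U)))⁻¹ ≤
            StructuredTucker.kappaBTD n l A ∧
        ((∃ x, x ≠ 0 ∧ (StructuredTucker.blockMatrix U).mulVec x = 0) →
          StructuredTucker.kappaBTD n l A = ⊤) := by
  -- The field `multilinearRank` is, by definition, the inclusion `M r ⊆ fullRankCores (l r)`.
  have hsub := fun r => StructuredTucker.structuredTucker_mono n (hM r).multilinearRank
  have hB := fun r => hsub r (hA r)
  exact ⟨hB, StructuredTucker.condNumber_mono _ (fun B (h : ∀ r, _) r => hsub r (h r)) A, fun U C h =>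
    ⟨StructuredTucker.inv_sigmaMin_le_kappaBTD hR hl hB h, StructuredTucker.kappaBTD_eq_top hB h⟩⟩
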